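/- Let $X$ be a $T_1$ topological space and let $X_{top}$ be the poset of its open sets, regarded as a category. A *topological étale groupoid over $X$* is a groupoid $\mathcal G$ with object set $X$ whose set of morphisms $\mathcal G_1$ is a topological space, such that the source $s$, the target $t$, the identities map $i$, inversion and composition are continuous and $s,t:\mathcal G_1\to X$ are local homeomorphisms. Two of them are isomorphic if there is an isomorphism of groupoids between them that is the identity on $X$ and a homeomorphism on morphisms. Let $\mathcal C$ be a small category that contains $X_{top}$ as a subcategory and has the same objects as $X_{top}$. For $x,y\in X$ and an open set $V$, let $\mathcal C_x(V)$ be the stalk at $x$ of the presheaf $\mathcal C(-,V)$ on $X$, and let $\mathcal C_x^y:=\varprojlim_{V\ni y}\mathcal C_x(V)$. Composition in $\mathcal C$ induces maps $\mathcal C_y^z\times\mathcal C_x^y\to\mathcal C_x^z$, hence a category $\mathcal C^\star$ with object set $X$ and $\mathcal C^\star(x,y)=\mathcal C_x^y$. The category $\mathcal C$ is a *pseudogroup sheaf on $X$* if 1. for all $x\in X$ and all open $V$ the map $\coprod_{y\in V}\mathcal C_x^y\to\mathcal C_x(V)$ given by the natural projections is bijective; 2. $\mathcal C^\star$ is a groupoid;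 3. for every open $V$ the presheaf $\mathcal C(-,V)$ is a sheaf. Two pseudogroup sheaves on $X$ are isomorphic if there is an isomorphism of categories between them that restricts to the identity on $X_{top}$. For a topological étale groupoid $\mathcal G$ over $X$ let $\hat{\mathcal G}$ be the category of its local sections: its objects are the open sets of $X$; $\hat{\mathcal G}(U,V)$ is the set of continuous maps $f:U\to t^{-1}(V)$ with $s\circ f=\mathrm{id}_U$; the composite of $f\in\hat{\mathcal G}(U,V)$ and $g\in\hat{\mathcal G}(V,W)$ is $x\mapsto g(t(f(x)))\circ f(x)$; and an inclusion $U\subseteq V$ corresponds to $i|_U$. For a pseudogroup sheaf $\mathcal C$ on $X$ give the set of morphisms $\coprod_{x,y}\mathcal C_x^y\cong\coprod_x\mathcal C_x(X)$ of $\mathcal C^\star$ the topology of the étale space of the presheaf $\mathcal C(-,X)$. **Theorem.** For every topological étale groupoid $\mathcal G$ over $X$, the category $\hat{\mathcal G}$ is a pseudogroup sheaf on $X$. For every pseudogroup sheaf $\mathcal C$ on $X$, the groupoid $\mathcal C^\star$ is a topological étale groupoid over $X$. The assignments $\mathcal G\mapsto\hat{\mathcal G}$ and $\mathcal C\mapsto\mathcal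 C^\star$ induce mutually inverse bijections between the isomorphism classes of topological étale groupoids over $X$ and the isomorphism classes of pseudogroup sheaves on $X$. -/

import Mathlib

open CategoryTheory TopologicalSpace Opposite

universe u

/-! ## Small categories on a space, étale groupoids -/

/-- A small category with set of objects `X`, given by its set of morphisms `Mor`, source `s`,
target `t`, identities `i` and composition `comp g f _ = g ∘ f` (defined when `t f = s g`),
together with a topology on `Mor`.  No compatibility between the topology and the structure maps is
required here. -/
structure CategoryOver (X : TopCat.{u}) where
  Mor : Type u
  top : TopologicalSpace Mor
  s : Mor → X
  t : Mor → X
  i : X → Mor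
  comp : (g f : Mor) → t f = s g → Mor
  s_i : ∀ x, s (i x) = x
  t_i : ∀ x, t (i x) = x
  s_comp : ∀ g f h, s (comp g f h) = s f
  t_comp : ∀ g f h, t (comp g f h) = t g
  id_comp : ∀ f, comp (i (t f)) f (s_i (t f)).symm = f
  comp_id : ∀ f, comp f (i (s f)) (t_i (s f)) = f
  assoc : ∀ (k g f : Mor) (hf : t f = s g) (hg : t g = s k),
    comp (comp k g hg) f (hf.trans (s_comp k g hg).symm) =
      comp k (comp g f hf) ((t_comp g f hf).trans hg)

attribute [instance] CategoryOver.top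

/-- A topological étale groupoid with object space `X`: all the structure maps are continuous, and
the source and target maps are local homeomorphisms. -/
structure EtaleGroupoid (X : TopCat.{u}) extends CategoryOver X where
  inv : Mor → Mor
  s_inv : ∀ f, s (inv f) = t f
  t_inv : ∀ f, t (inv f) = s f
  inv_comp : ∀ f, comp (inv f) f (s_inv f).symm = i (s f)
  comp_inv : ∀ f, comp f (inv f) (t_inv f) = i (t f)
  continuous_s : Continuous s
  continuous_t : Continuous t
  continuous_i : Continuous i
  continuous_inv : Continuous inv
  continuous_comp :
    Continuous fun p : {p : Mor × Mor // t p.2 = s p.1} => comp p.1.1 p.1.2 p.2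
  etale_s : IsLocalHomeomorph s
  etale_t : IsLocalHomeomorph t

/-- Two étale groupoids over `X` are isomorphic (over `X`) if there is a functor between them which
is the identity on `X` and a homeomorphism on morphisms. -/
def EtaleGroupoid.Isomorphic {X : TopCat.{u}} (G H : EtaleGroupoid X) : Prop :=
  ∃ φ : G.Mor ≃ₜ H.Mor,
    (∀ f, H.s (φ f) = G.s f) ∧ (∀ f, H.t (φ f) = G.t f) ∧ (∀ x, φ (G.i x) = H.i x) ∧
    ∀ g f h h', φ (G.comp g f h) = H.comp (φ g) (φ f) h'

/-- The equivalence relation "isomorphic over `X`" on étale groupoids over `X`. -/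
def EtaleGroupoid.isoSetoid (X : TopCat.{u}) : Setoid (EtaleGroupoid X) where
  r := EtaleGroupoid.Isomorphic
  iseqv :=
    { refl := fun G => ⟨Homeomorph.refl _, fun _ => rfl, fun _ => rfl, fun _ => rfl,
        fun _ _ _ _ => rfl⟩
      symm := by
        rintro G H ⟨φ, hs, ht, hi, hc⟩
        have hs' : ∀ f, G.s (φ.symm f) = H.s f := fun f => by
          rw [← hs, φ.apply_symm_apply]
        have ht' : ∀ f, G.t (φ.symm f) = H.t f := fun f => by
          rw [← ht, φ.apply_symm_apply]
        refine ⟨φ.symm, hs', ht', fun x => ?_, fun g f h h' => ?_⟩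
        · rw [← hi, φ.symm_apply_apply]
        · apply φ.injective
          rw [φ.apply_symm_apply, hc _ _ h' (by simpa using h)]
          congr 1 <;> simp
      trans := by
        rintro G H K ⟨φ, hs, ht, hi, hc⟩ ⟨ψ, ks, kt, ki, kc⟩
        refine ⟨φ.trans ψ, fun f => ?_, fun f => ?_, fun x => ?_, fun g f h h' => ?_⟩
        · simp [ks, hs]
        · simp [kt, ht]
        · simp [ki, hi]
        · have h'' : H.t (φ f) = H.s (φ g) := by rw [hs, ht, h]
          simp only [Homeomorph.trans_apply]
          rw [hc g f h h'', kc _ _ h'' (by simpa using h')] }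

/-! ## Categories containing the poset of open sets -/

/-- A small category `C` whose objects are the open sets of `X`, together with a functor
`incl : X_top ⥤ C` which is the identity on objects (such a functor is automatically faithful,
i.e. an embedding, because `X_top` is a poset).  `Hom U V` is the set `C(U, V)` and
`comp g f = g ∘ f`. -/
structure OpensCategory (X : TopCat.{u}) where
  Hom : Opens X → Opens X → Type u
  id : (U : Opens X) → Hom U U
  comp : {U V W : Opens X} → Hom V W → Hom U V → Hom U W
  id_comp : ∀ {U V : Opens X} (f : Hom U V), comp (id V) f = f
  comp_id : ∀ {U V : Opens X} (f : Hom U V), comp f (id U) = f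
  assoc : ∀ {U V W Z : Opens X} (k : Hom W Z) (g : Hom V W) (f : Hom U V),
    comp (comp k g) f = comp k (comp g f)
  incl : {U V : Opens X} → U ≤ V → Hom U V
  incl_refl : ∀ U : Opens X, incl (le_refl U) = id U
  incl_comp : ∀ {U V W : Opens X} (h : U ≤ V) (k : V ≤ W),
    comp (incl k) (incl h) = incl (h.trans k)

namespace OpensCategory

variable {X : TopCat.{u}} (C : OpensCategory X)

/-- The presheaf `C(-, V)` on `X`. -/
def presheaf (V : Opens X) : TopCat.Presheaf (Type u) X where
  obj U := C.Hom U.unop V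
  map j := ↾fun f => C.comp f (C.incl j.unop.le)
  map_id U := by
    ext f
    exact (congrArg (C.comp f) (C.incl_refl _)).trans (C.comp_id f)
  map_comp j k := by
    ext f
    exact (congrArg (C.comp f) (C.incl_comp _ _)).symm.trans (C.assoc _ _ _).symm

/-- A morphism `g ∈ C(V, W)` induces a morphism of presheaves `C(-, V) ⟶ C(-, W)`. -/
def postcomp {V W : Opens X} (g : C.Hom V W) : C.presheaf V ⟶ C.presheaf W where
  app U := ↾fun f => C.comp g f
  naturality U U' j := by
    ext f
    exact (C.assoc _ _ _).symm

/-- `C_x(V)`, the stalk at `x` of the presheaf `C(-, V)`. -/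
abbrev Stalk (x : X) (V : Opens X) : Type u := (C.presheaf V).stalk x

/-- The class in `C_x(V)` of `f ∈ C(U, V)`, where `x ∈ U`. -/
noncomputable def germ {U V : Opens X} (f : C.Hom U V) (x : X) (hx : x ∈ U) : C.Stalk x V :=
  (C.presheaf V).germ U x hx f

/-- The map `C_x(V) → C_x(W)` induced by `g ∈ C(V, W)`. -/
noncomputable def push {V W : Opens X} (g : C.Hom V W) (x : X) (a : C.Stalk x V) : C.Stalk x W :=
  (TopCat.Presheaf.stalkFunctor (Type u) x).map (C.postcomp g) a

theorem exists_germ_eq {x : X} {V : Opens X} (a : C.Stalk x V) :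
    ∃ (U : Opens X) (hx : x ∈ U) (f : C.Hom U V), C.germ f x hx = a :=
  (C.presheaf V).exists_germ_eq a

theorem germ_comp_incl {U U' V : Opens X} (f : C.Hom U V) (h : U' ≤ U) (x : X) (hx : x ∈ U') :
    C.germ (C.comp f (C.incl h)) x hx = C.germ f x (h hx) :=
  TopCat.Presheaf.germ_res_apply (C.presheaf V) (homOfLE h) x hx f

theorem push_germ {U V W : Opens X} (g : C.Hom V W) (f : C.Hom U V) (x : X) (hx : x ∈ U) :
    C.push g x (C.germ f x hx) = C.germ (C.comp g f) x hx :=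
  TopCat.Presheaf.stalkFunctor_map_germ_apply U x hx (C.postcomp g) f

theorem push_comp {V W Z : Opens X} (k : C.Hom W Z) (g : C.Hom V W) (x : X) (a : C.Stalk x V) :
    C.push (C.comp k g) x a = C.push k x (C.push g x a) := by
  obtain ⟨U, hx, f, rfl⟩ := C.exists_germ_eq a
  simp only [push_germ, C.assoc]

theorem push_id {V : Opens X} (x : X) (a : C.Stalk x V) : C.push (C.id V) x a = a := by
  obtain ⟨U, hx, f, rfl⟩ := C.exists_germ_eq a
  simp only [push_germ, C.id_comp]

/-- `C_x^y`, the inverse limit of the sets `C_x(V)` over the open neighbourhoods `V` of `y` (with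
transition maps induced by the inclusions `V ⊆ W`), realised as the set of compatible families. -/
@[ext]
structure Germ (x y : X) where
  val : (V : Opens X) → y ∈ V → C.Stalk x V
  compat : ∀ {V W : Opens X} (h : V ≤ W) (hV : y ∈ V),
    C.push (C.incl h) x (val V hV) = val W (h hV)

variable {C}

namespace Germ

/-- The identity of `x` in `C⋆`: the family of germs at `x` of the identities of the open
neighbourhoods of `x`. -/
noncomputable def id (C : OpensCategory X) (x : X) : C.Germ x x where
  val V hV := C.germ (C.id V) x hV
  compat {V W} h hV := by
    rw [push_germ, C.comp_id, ← C.germ_comp_incl (C.id W) h x hV, C.id_comp]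

/-- Composition of `b ∈ C_y(W)` with `a ∈ C_x^y`, with values in `C_x(W)`: if `b` is the germ at `y`
of `g ∈ C(V, W)`, then the result is the image of `a_V ∈ C_x(V)` under the map induced by `g`. -/
noncomputable def act {x y : X} (a : C.Germ x y) (W : Opens X) : C.Stalk y W ⟶ C.Stalk x W :=
  Limits.colimit.desc ((OpenNhds.inclusion y).op ⋙ C.presheaf W)
    { pt := C.Stalk x W
      ι :=
        { app := fun V => ↾fun g => C.push g x (a.val V.unop.1 V.unop.2)
          naturality := fun V V' j => by
            ext g
            exact (C.push_comp _ _ _ _).trans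
              (congrArg (C.push g x) (a.compat (leOfHom j.unop) _)) } }

theorem act_germ {x y : X} (a : C.Germ x y) {V W : Opens X} (g : C.Hom V W) (hy : y ∈ V) :
    a.act W (C.germ g y hy) = C.push g x (a.val V hy) :=
  ConcreteCategory.congr_hom (Limits.colimit.ι_desc
    (F := (OpenNhds.inclusion y).op ⋙ C.presheaf W) _ (op ⟨V, hy⟩)) g

theorem act_push {x y : X} (a : C.Germ x y) {V W : Opens X} (k : C.Hom V W) (b : C.Stalk y V) :
    a.act W (C.push k y b) = C.push k x (a.act V b) := by
  obtain ⟨U, hy, g, rfl⟩ := C.exists_germ_eq b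
  rw [push_germ, act_germ, act_germ, push_comp]

/-- The composition `C_y^z × C_x^y → C_x^z` induced by the composition of `C`. -/
noncomputable def comp {x y z : X} (b : C.Germ y z) (a : C.Germ x y) : C.Germ x z where
  val W hW := a.act W (b.val W hW)
  compat h hV := by rw [← act_push, b.compat]

theorem id_comp {x y : X} (a : C.Germ x y) : (Germ.id C y).comp a = a := by
  ext W hW
  change a.act W (C.germ (C.id W) y hW) = _
  rw [act_germ, push_id]

theorem comp_id {x y : X} (a : C.Germ x y) : a.comp (Germ.id C x) = a := by
  ext W hW
  change (Germ.id C x).act W (a.val W hW) = a.val W hW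
  obtain ⟨U, hx, f, hf⟩ := C.exists_germ_eq (a.val W hW)
  rw [← hf, act_germ]
  change C.push f x (C.germ (C.id U) x hx) = _
  rw [push_germ, C.comp_id]

theorem assoc {w x y z : X} (c : C.Germ y z) (b : C.Germ x y) (a : C.Germ w x) :
    (c.comp b).comp a = c.comp (b.comp a) := by
  ext W hW
  change a.act W (b.act W (c.val W hW)) = (b.comp a).act W (c.val W hW)
  obtain ⟨U, hy, f, hf⟩ := C.exists_germ_eq (c.val W hW)
  rw [← hf, act_germ, act_germ, act_push]
  rfl

end Germ

variable (C)

/-- The set of morphisms of `C⋆`: the disjoint union of the `C_x^y` over all `x, y ∈ X`. -/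
structure StarMor where
  src : X
  tgt : X
  germ : C.Germ src tgt

/-- The map from the set of morphisms of `C⋆` to the étale space of the presheaf `C(-, X)`, sending
`a ∈ C_x^y` to its component in `C_x(X)`.  It is a bijection when `C` is a pseudogroup sheaf. -/
def StarMor.toEtaleSpace (a : C.StarMor) : (C.presheaf ⊤).EtaleSpace where
  base := a.src
  germ := a.germ.val ⊤ trivial

/-- The germ category `C⋆` with set of objects `X` and `C⋆(x, y) = C_x^y`.  Its set of morphisms
carries the topology of the étale space of `C(-, X)`, transported along
`StarMor.toEtaleSpace`. -/
noncomputable def star : CategoryOver X where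
  Mor := C.StarMor
  top := TopologicalSpace.induced (StarMor.toEtaleSpace C) inferInstance
  s a := a.src
  t a := a.tgt
  i x := ⟨x, x, Germ.id C x⟩
  comp b a h := ⟨a.src, b.tgt, b.germ.comp (h ▸ a.germ)⟩
  s_i _ := rfl
  t_i _ := rfl
  s_comp _ _ _ := rfl
  t_comp _ _ _ := rfl
  id_comp := by
    rintro ⟨x, y, a⟩
    exact congrArg (StarMor.mk x y) (Germ.id_comp a)
  comp_id := by
    rintro ⟨x, y, a⟩
    exact congrArg (StarMor.mk x y) (Germ.comp_id a)
  assoc := by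
    rintro ⟨y, z, c⟩ ⟨x, y', b⟩ ⟨w, x', a⟩ hf hg
    dsimp only at hf hg
    subst hf hg
    exact congrArg (StarMor.mk w z) (Germ.assoc c b a)

end OpensCategory

/-- A pseudogroup sheaf on `X`: a small category `C ⊇ X_top` with the same objects as `X_top` such
that
* for all `x` and `V` the projections `C_x^y → C_x(V)`, `y ∈ V`, exhibit `C_x(V)` as the disjoint
  union of the `C_x^y`, `y ∈ V`;
* the category `C⋆` is a groupoid;
* every presheaf `C(-, V)` is a sheaf. -/
structure PseudogroupSheaf (X : TopCat.{u}) extends OpensCategory X where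
  stalk_coprod : ∀ (x : X) (V : Opens X), Function.Bijective
    fun p : (Σ y : V, toOpensCategory.Germ x (y : X)) => p.2.val V p.1.2
  star_groupoid : ∀ {x y : X} (a : toOpensCategory.Germ x y), ∃ b : toOpensCategory.Germ y x,
    b.comp a = OpensCategory.Germ.id toOpensCategory x ∧
      a.comp b = OpensCategory.Germ.id toOpensCategory y
  isSheaf : ∀ V : Opens X, (toOpensCategory.presheaf V).IsSheaf

/-- Two pseudogroup sheaves on `X` are isomorphic if there is an isomorphism of categories between
them which restricts to the identity on `X_top`. -/
def PseudogroupSheaf.Isomorphic {X : TopCat.{u}} (C D : PseudogroupSheaf X) : Prop :=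
  ∃ φ : (U V : Opens X) → C.Hom U V ≃ D.Hom U V,
    (∀ (U V W : Opens X) (g : C.Hom V W) (f : C.Hom U V),
      φ U W (C.comp g f) = D.comp (φ V W g) (φ U V f)) ∧
    ∀ (U V : Opens X) (h : U ≤ V), φ U V (C.incl h) = D.incl h

/-- The equivalence relation "isomorphic relative to `X_top`" on pseudogroup sheaves on `X`. -/
def PseudogroupSheaf.isoSetoid (X : TopCat.{u}) : Setoid (PseudogroupSheaf X) where
  r := PseudogroupSheaf.Isomorphic
  iseqv :=
    { refl := fun C => ⟨fun _ _ => Equiv.refl _, fun _ _ _ _ _ => rfl, fun _ _ _ => rfl⟩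
      symm := by
        rintro C D ⟨φ, hc, hi⟩
        refine ⟨fun U V => (φ U V).symm, fun U V W g f => ?_, fun U V h => ?_⟩
        · rw [Equiv.symm_apply_eq, hc, Equiv.apply_symm_apply, Equiv.apply_symm_apply]
        · rw [Equiv.symm_apply_eq, hi]
      trans := by
        rintro C D E ⟨φ, hc, hi⟩ ⟨ψ, kc, ki⟩
        refine ⟨fun U V => (φ U V).trans (ψ U V), fun U V W g f => ?_, fun U V h => ?_⟩
        · simp [hc, kc]
        · simp [hi, ki] }

/-- The category `Ĝ` of local sections of an étale groupoid `G` over `X`: `Ĝ(U, V)` is the set of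
continuous maps `f : U → t⁻¹(V)` with `s ∘ f = id`.  The composite of `f ∈ Ĝ(U, V)` and
`g ∈ Ĝ(V, W)` is `x ↦ g(t(f(x))) ∘ f(x)`, and `U ⊆ V` corresponds to the section `x ↦ i(x)`. -/
def EtaleGroupoid.sections {X : TopCat.{u}} (G : EtaleGroupoid X) : OpensCategory X where
  Hom U V := {f : U → G.Mor // Continuous f ∧ (∀ x, G.s (f x) = x) ∧ ∀ x, G.t (f x) ∈ V}
  id U := ⟨fun x => G.i x, G.continuous_i.comp continuous_subtype_val, fun x => G.s_i x,
    fun x => by rw [G.t_i]; exact x.2⟩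
  comp {U V W} g f := ⟨fun x => G.comp (g.1 ⟨G.t (f.1 x), f.2.2.2 x⟩) (f.1 x)
      (g.2.2.1 ⟨G.t (f.1 x), f.2.2.2 x⟩).symm, by
      have h1 : Continuous fun x : U => g.1 ⟨G.t (f.1 x), f.2.2.2 x⟩ :=
        g.2.1.comp ((G.continuous_t.comp f.2.1).subtype_mk _)
      exact G.continuous_comp.comp ((h1.prodMk f.2.1).subtype_mk fun x =>
        (g.2.2.1 ⟨G.t (f.1 x), f.2.2.2 x⟩).symm),
    fun x => by rw [G.s_comp, f.2.2.1], fun x => by rw [G.t_comp]; exact g.2.2.2 _⟩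
  id_comp {U V} f := Subtype.ext (funext fun x => G.id_comp (f.1 x))
  comp_id {U V} f := by
    refine Subtype.ext (funext fun x => ?_)
    have key : ∀ (y : U) (hy : y = x) (h : G.t (G.i x) = G.s (f.1 y)),
        G.comp (f.1 y) (G.i x) h = f.1 x := by
      rintro y rfl h
      have := G.comp_id (f.1 y)
      simpa only [f.2.2.1] using this
    exact key _ (Subtype.ext (G.t_i x)) _
  assoc {U V W Z} k g f := by
    refine Subtype.ext (funext fun x => ?_)
    have key : ∀ (y y' : W) (hy : y = y') (m n : G.Mor) (h1 : G.t n = G.s m)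
        (h2 : G.t m = G.s (k.1 y)) (h3 : G.t n = G.s (G.comp (k.1 y) m h2))
        (h4 : G.t (G.comp m n h1) = G.s (k.1 y')),
        G.comp (G.comp (k.1 y) m h2) n h3 = G.comp (k.1 y') (G.comp m n h1) h4 := by
      rintro y _ rfl m n h1 h2 h3 h4
      exact G.assoc _ _ _ h1 h2
    exact key _ _ (Subtype.ext (G.t_comp _ _ _).symm) _ _ _ _ _ _
  incl {U V} h := ⟨fun x => G.i x, G.continuous_i.comp continuous_subtype_val, fun x => G.s_i x,
    fun x => by rw [G.t_i]; exact h x.2⟩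
  incl_refl U := rfl
  incl_comp {U V W} h k := by
    refine Subtype.ext (funext fun x => ?_)
    have key : ∀ (y : X) (hy : y = x) (e : G.t (G.i x) = G.s (G.i y)),
        G.comp (G.i y) (G.i x) e = G.i x := by
      rintro y rfl e
      have := G.id_comp (G.i x)
      simpa only [G.t_i] using this
    exact key _ (G.t_i x) _

/-! By condition 1, the germ at x ∈ U of f ∈ C(U, V) comes from exactly one arrow of C⋆ with source
x and target in V. So f defines a section over U of the source map of C⋆, whose image is open and is
mapped homeomorphically onto U by s (`starMor_ext`, `isOpen_representedBy`). Hence s is a local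
homeomorphism, and so is t, being s after inversion; continuity of composition and inversion is
checked on representatives.

Conversely, two sections of a local homeomorphism s through the same point agree nearby, so Ĝ_x(V)
is the set of arrows of G with source x and target in V (`germ_eq_germ_iff`). An element of Ĝ_x^y is
then a single arrow whose target lies in every neighbourhood of y, hence equals y because X is T₁
(`t_germValue`). This gives conditions 1 and 2 for Ĝ, and also Ĝ⋆ ≅ G; condition 3 holds because
continuous sections glue. The argument is run for any C with a `SectionsIso` to Ĝ, which also covers
the invariance of C⋆ under isomorphism.

Finally, C(U, V) maps bijectively to the sections of C⋆ over U with targets in V: injectively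
because C(-, V) is separated, surjectively because local representatives of a continuous section
glue (`exists_localSection_eq`). -/

open Topology

/-! ### Representatives of morphisms of C⋆ -/

namespace OpensCategory

variable {X : TopCat.{u}} {C : OpensCategory X}

theorem exists_comp_incl_eq_of_germ_eq {U U' V : Opens X} {f : C.Hom U V} {f' : C.Hom U' V} {x : X}
    {hx : x ∈ U} {hx' : x ∈ U'} (h : C.germ f x hx = C.germ f' x hx') :
    ∃ (W : Opens X) (_ : x ∈ W) (k : W ≤ U) (k' : W ≤ U'),
      C.comp f (C.incl k) = C.comp f' (C.incl k') := by
  obtain ⟨W, hW, i, j, e⟩ := (C.presheaf V).germ_eq x hx hx' f f' h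
  exact ⟨W, hW, i.le, j.le, e⟩

namespace StarMor

/-- The morphism `a : x ⟶ y` of `C⋆` is represented by `f ∈ C(U, V)` if `x ∈ U`, `y ∈ V` and the
component of `a` in `C_x(V)` is the germ of `f`. -/
def IsRepresentedBy (a : C.StarMor) {U V : Opens X} (f : C.Hom U V) : Prop :=
  ∃ (hU : a.src ∈ U) (hV : a.tgt ∈ V), a.germ.val V hV = C.germ f a.src hU

/-- The set of all morphisms of `C⋆` represented by `f`. -/
def representedBy {U V : Opens X} (f : C.Hom U V) : Set C.StarMor :=
  {a | a.IsRepresentedBy f}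

theorem exists_isRepresentedBy (a : C.StarMor) (V : Opens X) (hV : a.tgt ∈ V) :
    ∃ (U : Opens X) (f : C.Hom U V), a.IsRepresentedBy f := by
  obtain ⟨U, hU, f, hf⟩ := C.exists_germ_eq (a.germ.val V hV)
  exact ⟨U, f, hU, hV, hf.symm⟩

theorem isRepresentedBy_comp_incl_iff {a : C.StarMor} {U U' V : Opens X} {f : C.Hom U V}
    (h : U' ≤ U) : a.IsRepresentedBy (C.comp f (C.incl h)) ↔
      a.IsRepresentedBy f ∧ a.src ∈ U' := by
  constructor
  · rintro ⟨hU, hV, e⟩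
    exact ⟨⟨h hU, hV, e.trans (C.germ_comp_incl f h _ hU)⟩, hU⟩
  · rintro ⟨⟨hU, hV, e⟩, hU'⟩
    exact ⟨hU', hV, e.trans (C.germ_comp_incl f h _ hU').symm⟩

theorem IsRepresentedBy.incl_comp {a : C.StarMor} {U V W : Opens X} {f : C.Hom U V}
    (hf : a.IsRepresentedBy f) (h : V ≤ W) : a.IsRepresentedBy (C.comp (C.incl h) f) := by
  obtain ⟨hU, hV, e⟩ := hf
  exact ⟨hU, h hV, by rw [← a.germ.compat h hV, e, push_germ]⟩

theorem IsRepresentedBy.exists_comp_incl_eq {a : C.StarMor} {U U' V : Opens X} {f : C.Hom U V}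
    {f' : C.Hom U' V} (hf : a.IsRepresentedBy f) (hf' : a.IsRepresentedBy f') :
    ∃ (W : Opens X) (_ : a.src ∈ W) (k : W ≤ U) (k' : W ≤ U'),
      C.comp f (C.incl k) = C.comp f' (C.incl k') := by
  obtain ⟨hU, hV, e⟩ := hf
  obtain ⟨hU', _, e'⟩ := hf'
  exact exists_comp_incl_eq_of_germ_eq (e.symm.trans e')

theorem IsRepresentedBy.comp {b a : C.StarMor} {U V W : Opens X} {g : C.Hom V W} {f : C.Hom U V}
    (hg : b.IsRepresentedBy g) (hf : a.IsRepresentedBy f) (h : a.tgt = b.src) :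
    IsRepresentedBy (C.star.comp b a h : C.StarMor) (C.comp g f) := by
  obtain ⟨x, y, a⟩ := a
  obtain ⟨y', z, b⟩ := b
  dsimp only at h
  subst h
  obtain ⟨hU, hV, e⟩ := hf
  obtain ⟨_, hW, e'⟩ := hg
  refine ⟨hU, hW, ?_⟩
  dsimp only at *
  change a.act W (b.val W hW) = _
  rw [e', Germ.act_germ, e, push_germ]
  rfl

theorem isRepresentedBy_id_iff {x : X} {U V : Opens X} (h : U ≤ V) :
    IsRepresentedBy (C.star.i x : C.StarMor) (C.incl h) ↔ x ∈ U := by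
  refine ⟨fun ⟨hU, _, _⟩ => hU, fun hU => ⟨hU, h hU, ?_⟩⟩
  change C.germ (C.id V) x _ = _
  rw [← C.germ_comp_incl (C.id V) h x hU, C.id_comp]
  rfl

noncomputable instance : TopologicalSpace C.StarMor := C.star.top

end StarMor

end OpensCategory

/-! ### C⋆ as an étale groupoid -/

namespace PseudogroupSheaf

open OpensCategory OpensCategory.StarMor

variable {X : TopCat.{u}} (C : PseudogroupSheaf X)

-- This is the injectivity half of condition 1: the two components in C_x(V) are the same germ,
-- which forces even the targets to agree.
variable {C} in
theorem starMor_ext {a b : C.StarMor} {U V : Opens X} {f : C.Hom U V}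
    (ha : a.IsRepresentedBy f) (hb : b.IsRepresentedBy f) (h : a.src = b.src) : a = b := by
  obtain ⟨x, y, a⟩ := a
  obtain ⟨x', y', b⟩ := b
  dsimp only at h
  subst h
  obtain ⟨hU, hV, e⟩ := ha
  obtain ⟨_, hV', e'⟩ := hb
  have := @(C.stalk_coprod x V).1 ⟨⟨y, hV⟩, a⟩ ⟨⟨y', hV'⟩, b⟩ (e.trans e'.symm)
  obtain ⟨hy, hab⟩ := Sigma.mk.inj_iff.1 this
  obtain rfl := congrArg Subtype.val hy
  exact congrArg (StarMor.mk x y) (eq_of_heq hab)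

theorem exists_localSection {U V : Opens X} (f : C.Hom U V) (x : U) :
    ∃ a : C.StarMor, a.src = x ∧ a.IsRepresentedBy f := by
  obtain ⟨⟨y, b⟩, h⟩ := (C.stalk_coprod x V).2 (C.germ f x x.2)
  exact ⟨⟨x, y, b⟩, rfl, x.2, y.2, h⟩

/-- The section of the source map `C⋆ → X` over `U` defined by `f ∈ C(U, V)`: it sends `x` to the
morphism with source `x` represented by `f`. -/
noncomputable def localSection {U V : Opens X} (f : C.Hom U V) (x : U) : C.StarMor :=
  (C.exists_localSection f x).choose

theorem localSection_src {U V : Opens X} (f : C.Hom U V) (x : U) : (C.localSection f x).src = x :=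
  (C.exists_localSection f x).choose_spec.1

theorem localSection_isRepresentedBy {U V : Opens X} (f : C.Hom U V) (x : U) :
    (C.localSection f x).IsRepresentedBy f :=
  (C.exists_localSection f x).choose_spec.2

theorem localSection_tgt_mem {U V : Opens X} (f : C.Hom U V) (x : U) : (C.localSection f x).tgt ∈ V :=
  (C.localSection_isRepresentedBy f x).2.1

variable {C} in
theorem eq_localSection {a : C.StarMor} {U V : Opens X} {f : C.Hom U V} (h : a.IsRepresentedBy f) :
    a = C.localSection f ⟨a.src, h.1⟩ :=
  starMor_ext h (C.localSection_isRepresentedBy f _) (C.localSection_src f ⟨a.src, h.1⟩).symm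

/-- The basic open sets come from sections of C(-, X), so f is first extended to have codomain X.
Nothing is gained by this: an arrow represented by the extension coincides with the value of
`localSection f` at its source, so its target already lies in V. -/
theorem isOpen_representedBy {U V : Opens X} (f : C.Hom U V) : IsOpen (representedBy f) := by
  refine ⟨_, GenerateOpen.basic _ ⟨U, C.comp (C.incl le_top) f, rfl⟩, Set.ext fun a => ?_⟩
  constructor
  · rintro ⟨hU, e⟩
    have h1 : a.IsRepresentedBy (C.comp (C.incl le_top) f) := ⟨hU, trivial, e⟩
    have h2 := (C.localSection_isRepresentedBy f ⟨a.src, hU⟩)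
    have : a = C.localSection f ⟨a.src, hU⟩ :=
      starMor_ext h1 (h2.incl_comp le_top) (C.localSection_src f ⟨a.src, hU⟩).symm
    change IsRepresentedBy a f
    rw [this]
    exact h2
  · intro h
    obtain ⟨hU, hV, e⟩ := h.incl_comp (W := ⊤) le_top
    exact ⟨hU, e⟩

-- The germs of sections of C(-, X) generate the topology, so only representatives with codomain X
-- need testing.
variable {C} in
theorem continuous_of_representedBy {Y : Type*} [TopologicalSpace Y] {φ : Y → C.StarMor}
    (h : ∀ (y : Y) (V : Opens X) (f : C.Hom V ⊤), (φ y).IsRepresentedBy f →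
      ∀ᶠ y' in 𝓝 y, (φ y').IsRepresentedBy f) : Continuous φ := by
  refine continuous_induced_rng.2 (continuous_generateFrom_iff.2 ?_)
  rintro _ ⟨U, f, rfl⟩
  refine isOpen_iff_mem_nhds.2 fun y hy => ?_
  obtain ⟨hU, e⟩ := hy
  filter_upwards [h y U f ⟨hU, trivial, e⟩] with y' hy'
  obtain ⟨hU, hV, e⟩ := hy'
  exact ⟨hU, e⟩

theorem continuous_localSection {U V : Opens X} (f : C.Hom U V) : Continuous (C.localSection f) := by
  refine continuous_of_representedBy fun x W g hg => ?_
  -- Two representatives of one arrow agree on a neighbourhood W of its source, so g still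
  -- represents the values of the section over W.
  obtain ⟨W, hW, k, k', e⟩ :=
    ((C.localSection_isRepresentedBy f x).incl_comp le_top).exists_comp_incl_eq hg
  rw [localSection_src] at hW
  filter_upwards [(W.isOpen.preimage continuous_subtype_val).mem_nhds hW] with x' hx'
  refine ((isRepresentedBy_comp_incl_iff k').1 (e ▸ (isRepresentedBy_comp_incl_iff k).2
    ⟨(C.localSection_isRepresentedBy f x').incl_comp le_top, ?_⟩)).1
  rw [localSection_src]
  exact hx'

theorem continuous_src : Continuous (StarMor.src : C.StarMor → X) := by
  refine continuous_iff_continuousAt.2 fun a => ?_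
  refine (nhds_basis_opens _).tendsto_right_iff.2 fun W hW => ?_
  obtain ⟨U, f, hf⟩ := a.exists_isRepresentedBy ⊤ trivial
  let W' : Opens X := ⟨W, hW.2⟩
  refine Filter.mem_of_superset ((C.isOpen_representedBy
    (C.comp f (C.incl (inf_le_left : U ⊓ W' ≤ U)))).mem_nhds
      ((isRepresentedBy_comp_incl_iff _).2 ⟨hf, hf.1, hW.1⟩)) fun b hb => ?_
  exact ((isRepresentedBy_comp_incl_iff _).1 hb).2.2

theorem continuous_tgt : Continuous (StarMor.tgt : C.StarMor → X) := by
  refine continuous_iff_continuousAt.2 fun a => ?_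
  refine (nhds_basis_opens _).tendsto_right_iff.2 fun W hW => ?_
  -- With the given neighbourhood as codomain of f, every arrow represented by f ends in it.
  obtain ⟨U, f, hf⟩ := a.exists_isRepresentedBy ⟨W, hW.2⟩ hW.1
  exact Filter.mem_of_superset ((C.isOpen_representedBy f).mem_nhds hf) fun b hb => hb.2.1

/-- The source map identifies the set of morphisms represented by `f ∈ C(U, V)` with `U`. -/
noncomputable def representedByHomeomorph {U V : Opens X} (f : C.Hom U V) :
    representedBy f ≃ₜ U where
  toFun a := ⟨a.1.src, a.2.1⟩
  invFun x := ⟨C.localSection f x, C.localSection_isRepresentedBy f x⟩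
  left_inv a := Subtype.ext (eq_localSection a.2).symm
  right_inv x := Subtype.ext (C.localSection_src f x)
  continuous_toFun := (C.continuous_src.comp continuous_subtype_val).subtype_mk _
  continuous_invFun := (C.continuous_localSection f).subtype_mk _

theorem isLocalHomeomorph_src : IsLocalHomeomorph (StarMor.src : C.StarMor → X) := by
  refine isLocalHomeomorph_iff_isOpenEmbedding_restrict.2 fun a => ?_
  obtain ⟨U, f, hf⟩ := a.exists_isRepresentedBy ⊤ trivial
  exact ⟨_, (C.isOpen_representedBy f).mem_nhds hf,
    U.isOpenEmbedding'.comp (C.representedByHomeomorph f).isOpenEmbedding⟩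

theorem continuous_star_i : Continuous fun x : X => (C.star.i x : C.StarMor) := by
  have : (fun x : X => (C.star.i x : C.StarMor)) =
      C.localSection (C.incl (le_refl ⊤)) ∘ fun x => ⟨x, trivial⟩ :=
    funext fun x => eq_localSection ((isRepresentedBy_id_iff (le_refl ⊤)).2 (Opens.mem_top x))
  rw [this]
  exact (C.continuous_localSection _).comp (continuous_id.subtype_mk _)

theorem continuous_star_comp :
    Continuous fun p : {p : C.StarMor × C.StarMor // p.2.tgt = p.1.src} =>
      (C.star.comp p.1.1 p.1.2 p.2 : C.StarMor) := by
  refine continuous_of_representedBy ?_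
  rintro ⟨⟨b, a⟩, h⟩ U k hk
  obtain ⟨V, g, hg⟩ := b.exists_isRepresentedBy ⊤ trivial
  -- The codomain of f is chosen to be the domain of g, so that g ∘ f exists in C; it then agrees
  -- with k near the source of a.
  obtain ⟨U', f, hf⟩ := a.exists_isRepresentedBy V (by rw [h]; exact hg.1)
  obtain ⟨W, hW, i, j, e⟩ := (hg.comp hf h).exists_comp_incl_eq hk
  have h1 : ∀ᶠ p : {p : C.StarMor × C.StarMor // p.2.tgt = p.1.src} in 𝓝 ⟨(b, a), h⟩,
      p.1.1.IsRepresentedBy g :=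
    ((C.isOpen_representedBy g).preimage
      (continuous_fst.comp continuous_subtype_val)).mem_nhds hg
  have h2 : ∀ᶠ p : {p : C.StarMor × C.StarMor // p.2.tgt = p.1.src} in 𝓝 ⟨(b, a), h⟩,
      p.1.2.IsRepresentedBy (C.comp f (C.incl i)) :=
    ((C.isOpen_representedBy _).preimage (continuous_snd.comp continuous_subtype_val)).mem_nhds
      ((isRepresentedBy_comp_incl_iff (a := a) i).2 ⟨hf, hW⟩)
  filter_upwards [h1, h2] with p hp1 hp2
  have := hp1.comp hp2 p.2
  rw [← C.assoc, e] at this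
  exact ((isRepresentedBy_comp_incl_iff j).1 this).1

/-- The inverse of a morphism of `C⋆`. -/
noncomputable def starInv (a : C.StarMor) : C.StarMor :=
  ⟨a.tgt, a.src, (C.star_groupoid a.germ).choose⟩

theorem starInv_comp (a : C.StarMor) : C.star.comp (C.starInv a) a rfl = C.star.i a.src :=
  congrArg (StarMor.mk _ _) (C.star_groupoid a.germ).choose_spec.1

theorem comp_starInv (a : C.StarMor) : C.star.comp a (C.starInv a) rfl = C.star.i a.tgt :=
  congrArg (StarMor.mk _ _) (C.star_groupoid a.germ).choose_spec.2

/-- Left inverses in a groupoid are unique. This recognises the inverse picked by choice in an arrow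
built from a representative. -/
theorem eq_starInv {a b : C.StarMor} (h : a.tgt = b.src)
    (e : C.star.comp b a h = C.star.i a.src) : b = C.starInv a := by
  obtain ⟨x, y, a⟩ := a
  obtain ⟨y', z, b⟩ := b
  dsimp only at h
  subst h
  obtain rfl : z = x := congrArg StarMor.tgt e
  refine congrArg (StarMor.mk y z) ?_
  have e' : b.comp a = Germ.id _ z := by
    simpa [OpensCategory.star] using e
  obtain ⟨_, h⟩ := (C.star_groupoid a).choose_spec
  change b = (C.star_groupoid a).choose
  generalize (C.star_groupoid a).choose = c at h
  rw [← Germ.comp_id b, ← h, ← Germ.assoc, e', Germ.id_comp]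

theorem continuous_starInv : Continuous C.starInv := by
  refine continuous_of_representedBy fun a V k hk => ?_
  obtain ⟨U, f, hf⟩ := a.exists_isRepresentedBy V hk.1
  have h := hk.comp hf rfl
  rw [starInv_comp] at h
  -- Since k ∘ f represents an identity, it agrees with an inclusion on W. For a' near a, the arrow
  -- represented by k at the target of a' is therefore a left inverse of a'.
  obtain ⟨W, hW, i, j, e⟩ := h.exists_comp_incl_eq
    ((isRepresentedBy_id_iff (le_refl ⊤)).2 (Opens.mem_top _))
  filter_upwards [(C.isOpen_representedBy (C.comp f (C.incl i))).mem_nhds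
    ((isRepresentedBy_comp_incl_iff i).2 ⟨hf, hW⟩)] with a' ha'
  have h1 := C.localSection_isRepresentedBy k ⟨a'.tgt, ha'.2.1⟩
  have h2 := (C.localSection_src k ⟨a'.tgt, ha'.2.1⟩).symm
  rw [← C.eq_starInv h2]
  · exact h1
  · have := h1.comp ha' h2
    rw [← C.assoc, e, C.incl_comp] at this
    exact starMor_ext this ((isRepresentedBy_id_iff _).2 ha'.1) rfl

/-- The étale groupoid `C⋆` of a pseudogroup sheaf. -/
noncomputable def starGroupoid : EtaleGroupoid X where
  toCategoryOver := C.star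
  inv := C.starInv
  s_inv _ := rfl
  t_inv _ := rfl
  inv_comp := C.starInv_comp
  comp_inv := C.comp_starInv
  continuous_s := C.continuous_src
  continuous_t := C.continuous_tgt
  continuous_i := C.continuous_star_i
  continuous_inv := C.continuous_starInv
  continuous_comp := C.continuous_star_comp
  etale_s := C.isLocalHomeomorph_src
  etale_t := by
    -- Inversion is a continuous involution, and t is s composed with it.
    let φ : C.StarMor ≃ₜ C.StarMor :=
      { toFun := C.starInv
        invFun := C.starInv
        left_inv := fun a => (C.eq_starInv rfl (C.comp_starInv a)).symm
        right_inv := fun a => (C.eq_starInv rfl (C.comp_starInv a)).symm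
        continuous_toFun := C.continuous_starInv
        continuous_invFun := C.continuous_starInv }
    exact C.isLocalHomeomorph_src.comp φ.isLocalHomeomorph

end PseudogroupSheaf

/-! ### Local sections of an étale groupoid -/

theorem CategoryOver.comp_congr {X : TopCat.{u}} (G : CategoryOver X) {g g' f f' : G.Mor}
    (hg : g = g') (hf : f = f') (h : G.t f = G.s g) (h' : G.t f' = G.s g') :
    G.comp g f h = G.comp g' f' h' := by
  subst hg hf
  rfl

namespace EtaleGroupoid

variable {X : TopCat.{u}} (G : EtaleGroupoid X)

theorem sections_comp_incl_apply {U U' V : Opens X} (f : G.sections.Hom U V) (h : U' ≤ U)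
    (x : U') : (G.sections.comp f (G.sections.incl h)).1 x = f.1 ⟨x, h x.2⟩ := by
  -- The composite evaluates f at t(i(x)), which equals x only propositionally; generalising the
  -- point allows substitution.
  have key : ∀ (y : U) (hy : y = ⟨x, h x.2⟩) (e : G.t (G.i x) = G.s (f.1 y)),
      G.comp (f.1 y) (G.i x) e = f.1 ⟨x, h x.2⟩ := by
    rintro y rfl e
    have := G.comp_id (f.1 ⟨x, h x.2⟩)
    simpa only [f.2.2.1] using this
  exact key _ (Subtype.ext (G.t_i x)) _

/-- The section is a local inverse of s at g, after its domain of definition has been shrunk to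
t⁻¹(V). -/
theorem exists_section_through (g : G.Mor) (V : Opens X) (hg : G.t g ∈ V) :
    ∃ (U : Opens X) (hU : G.s g ∈ U) (f : G.sections.Hom U V), f.1 ⟨G.s g, hU⟩ = g := by
  obtain ⟨e, he, hs⟩ := G.etale_s g
  let e' := e.restrOpen (G.t ⁻¹' V) (V.isOpen.preimage G.continuous_t)
  have he' : g ∈ e'.source := by
    rw [e.restrOpen_source]
    exact ⟨he, hg⟩
  have hs' : ∀ a, e' a = G.s a := fun a => (congrFun hs a).symm
  refine ⟨⟨e'.target, e'.open_target⟩, hs' g ▸ e'.map_source he',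
    ⟨fun x => e'.symm x, continuousOn_iff_continuous_domRestrict.1 e'.continuousOn_symm,
      fun x => ?_, fun x => ?_⟩, ?_⟩
  · rw [← hs', e'.right_inv x.2]
  · have := e'.map_target x.2
    rw [e.restrOpen_source] at this
    exact this.2
  · change e'.symm (G.s g) = g
    rw [← hs', e'.left_inv he']

/-- Functions glue uniquely; the conditions on s and t are pointwise and continuity is local. -/
theorem sections_presheaf_isSheaf (V : Opens X) : (G.sections.presheaf V).IsSheaf := by
  refine TopCat.Presheaf.isSheaf_of_isSheafUniqueGluing_types _ fun ι U sf₀ hsf => ?_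
  let sf : ∀ i, G.sections.Hom (U i) V := sf₀
  have hcompat : ∀ (i j : ι) (x : X) (hi : x ∈ U i) (hj : x ∈ U j),
      (sf i).1 ⟨x, hi⟩ = (sf j).1 ⟨x, hj⟩ := fun i j x hi hj => by
    have h : G.sections.comp (sf i) (G.sections.incl inf_le_left) =
      G.sections.comp (sf j) (G.sections.incl inf_le_right) := hsf i j
    have h' := congrFun (congrArg Subtype.val h) ⟨x, hi, hj⟩
    exact (G.sections_comp_incl_apply (sf i) inf_le_left _).symm.trans
      (h'.trans (G.sections_comp_incl_apply (sf j) inf_le_right _))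
  choose i hi using fun x : ↥(iSup U) => Opens.mem_iSup.1 x.2
  let s : ↥(iSup U) → G.Mor := fun x => (sf (i x)).1 ⟨x, hi x⟩
  have hs : ∀ j (x : U j), s ⟨x, Opens.mem_iSup.2 ⟨j, x.2⟩⟩ = (sf j).1 x := fun j x =>
    hcompat _ _ _ _ _
  refine ⟨⟨s, ?_, fun x => (sf (i x)).2.2.1 _, fun x => (sf (i x)).2.2.2 _⟩, fun j => ?_,
    fun s' hs' => ?_⟩
  · refine continuous_iff_continuousAt.2 fun x => ?_
    have hU : IsOpen {y : ↥(iSup U) | (y : X) ∈ U (i x)} :=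
      (U (i x)).isOpen.preimage continuous_subtype_val
    refine ContinuousOn.continuousAt (s := {y : ↥(iSup U) | (y : X) ∈ U (i x)}) ?_
      (hU.mem_nhds (hi x))
    rw [continuousOn_iff_continuous_domRestrict]
    have : Set.domRestrict {y : ↥(iSup U) | (y : X) ∈ U (i x)} s =
        (sf (i x)).1 ∘ fun y => ⟨y.1, y.2⟩ := funext fun y => hs (i x) ⟨y.1, y.2⟩
    rw [this]
    exact (sf (i x)).2.1.comp
      ((continuous_subtype_val.comp continuous_subtype_val).subtype_mk _)
  · refine Subtype.ext (funext fun x => ?_)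
    exact (G.sections_comp_incl_apply _ (le_iSup U j) x).trans (hs j x)
  · refine Subtype.ext (funext fun x => ?_)
    have h : G.sections.comp s' (G.sections.incl (le_iSup U (i x))) = sf (i x) := hs' (i x)
    have h' := congrFun (congrArg Subtype.val h) ⟨x, hi x⟩
    exact (G.sections_comp_incl_apply s' (le_iSup U (i x)) _).symm.trans h'

end EtaleGroupoid

/-! ### Germs of local sections as arrows of G -/

/-- An isomorphism, relative to `X_top`, between `C` and the category of local sections of `G`. -/
structure SectionsIso {X : TopCat.{u}} (C : OpensCategory X) (G : EtaleGroupoid X) where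
  equiv : (U V : Opens X) → C.Hom U V ≃ G.sections.Hom U V
  equiv_comp : ∀ {U V W : Opens X} (g : C.Hom V W) (f : C.Hom U V),
    equiv U W (C.comp g f) = G.sections.comp (equiv V W g) (equiv U V f)
  equiv_incl : ∀ {U V : Opens X} (h : U ≤ V), equiv U V (C.incl h) = G.sections.incl h

namespace SectionsIso

open OpensCategory

variable {X : TopCat.{u}} {C : OpensCategory X} {G : EtaleGroupoid X} (e : SectionsIso C G)

/-- The tautological isomorphism from the category of local sections to itself. -/
def refl (G : EtaleGroupoid X) : SectionsIso G.sections G where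
  equiv _ _ := Equiv.refl _
  equiv_comp _ _ := rfl
  equiv_incl _ := rfl

/-- The value at `x ∈ U` of the local section of `G` corresponding to `f ∈ C(U, V)`. -/
def eval {U V : Opens X} (f : C.Hom U V) (x : U) : G.Mor := (e.equiv U V f).1 x

theorem s_eval {U V : Opens X} (f : C.Hom U V) (x : U) : G.s (e.eval f x) = x :=
  (e.equiv U V f).2.2.1 x

theorem t_eval_mem {U V : Opens X} (f : C.Hom U V) (x : U) : G.t (e.eval f x) ∈ V :=
  (e.equiv U V f).2.2.2 x

theorem continuous_eval {U V : Opens X} (f : C.Hom U V) : Continuous (e.eval f) :=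
  (e.equiv U V f).2.1

theorem eval_comp {U V W : Opens X} (g : C.Hom V W) (f : C.Hom U V) (x : U) :
    e.eval (C.comp g f) x = G.comp (e.eval g ⟨G.t (e.eval f x), e.t_eval_mem f x⟩) (e.eval f x)
      (e.s_eval g ⟨_, e.t_eval_mem f x⟩).symm := by
  unfold eval
  simp only [e.equiv_comp]
  rfl

theorem eval_incl {U V : Opens X} (h : U ≤ V) (x : U) : e.eval (C.incl h) x = G.i x := by
  unfold eval
  rw [e.equiv_incl]
  rfl

theorem eval_comp_incl {U U' V : Opens X} (f : C.Hom U V) (h : U' ≤ U) (x : U') :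
    e.eval (C.comp f (C.incl h)) x = e.eval f ⟨x, h x.2⟩ := by
  unfold eval
  rw [e.equiv_comp, e.equiv_incl, G.sections_comp_incl_apply]

theorem germ_eq_germ_iff {U U' V : Opens X} {f : C.Hom U V} {f' : C.Hom U' V} {x : X} (hx : x ∈ U)
    (hx' : x ∈ U') : C.germ f x hx = C.germ f' x hx' ↔ e.eval f ⟨x, hx⟩ = e.eval f' ⟨x, hx'⟩ := by
  constructor
  · intro h
    obtain ⟨W, hW, k, k', h⟩ := exists_comp_incl_eq_of_germ_eq h
    have := congrArg (fun f => e.eval f ⟨x, hW⟩) h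
    simpa only [eval_comp_incl] using this
  · intro h
    -- s is injective on N, so the two sections agree wherever both take values in N; W is this open
    -- set, viewed in X.
    obtain ⟨N, hN, hxN, hinj⟩ := G.etale_s.isLocallyInjective (e.eval f ⟨x, hx⟩)
    let ι : ↥(U ⊓ U') → U := fun y => ⟨y, y.2.1⟩
    let ι' : ↥(U ⊓ U') → U' := fun y => ⟨y, y.2.2⟩
    have hι : Continuous ι := continuous_subtype_val.subtype_mk _
    have hι' : Continuous ι' := continuous_subtype_val.subtype_mk _
    have hM : IsOpen ((e.eval f ∘ ι) ⁻¹' N ∩ (e.eval f' ∘ ι') ⁻¹' N) :=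
      (hN.preimage ((e.continuous_eval f).comp hι)).inter
        (hN.preimage ((e.continuous_eval f').comp hι'))
    let W : Opens X := ⟨_, (U ⊓ U').isOpen.isOpenMap_subtype_val _ hM⟩
    have hxW : x ∈ W := ⟨⟨x, hx, hx'⟩, ⟨hxN, by
      change e.eval f' ⟨x, hx'⟩ ∈ N
      rwa [← h]⟩, rfl⟩
    have k : W ≤ U := by
      rintro _ ⟨y, -, rfl⟩
      exact y.2.1
    have k' : W ≤ U' := by
      rintro _ ⟨y, -, rfl⟩
      exact y.2.2
    have : C.comp f (C.incl k) = C.comp f' (C.incl k') := by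
      apply (e.equiv W V).injective
      refine Subtype.ext (funext fun z => ?_)
      change e.eval _ _ = e.eval _ _
      rw [eval_comp_incl, eval_comp_incl]
      obtain ⟨_, y, ⟨hy, hy'⟩, rfl⟩ := z
      exact hinj hy hy' ((e.s_eval f (ι y)).trans (e.s_eval f' (ι' y)).symm)
    rw [← C.germ_comp_incl f k x hxW, this, C.germ_comp_incl]

/-- The bijection from `C_x(V)` to the set of morphisms of `G` with source `x` and target in `V`. -/
noncomputable def value {x : X} {V : Opens X} (a : C.Stalk x V) : G.Mor :=
  e.eval (C.exists_germ_eq a).choose_spec.choose_spec.choose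
    ⟨x, (C.exists_germ_eq a).choose_spec.choose⟩

theorem value_germ {x : X} {U V : Opens X} (f : C.Hom U V) (hx : x ∈ U) :
    e.value (C.germ f x hx) = e.eval f ⟨x, hx⟩ :=
  (e.germ_eq_germ_iff _ _).1 (C.exists_germ_eq (C.germ f x hx)).choose_spec.choose_spec.choose_spec

theorem value_injective {x : X} {V : Opens X} :
    Function.Injective (e.value : C.Stalk x V → G.Mor) := by
  intro a b h
  obtain ⟨U, hU, f, rfl⟩ := C.exists_germ_eq a
  obtain ⟨U', hU', f', rfl⟩ := C.exists_germ_eq b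
  rw [value_germ, value_germ] at h
  exact (e.germ_eq_germ_iff _ _).2 h

theorem s_value {x : X} {V : Opens X} (a : C.Stalk x V) : G.s (e.value a) = x := by
  obtain ⟨U, hU, f, rfl⟩ := C.exists_germ_eq a
  rw [value_germ, s_eval]

theorem t_value_mem {x : X} {V : Opens X} (a : C.Stalk x V) : G.t (e.value a) ∈ V := by
  obtain ⟨U, hU, f, rfl⟩ := C.exists_germ_eq a
  rw [value_germ]
  exact e.t_eval_mem _ _

theorem exists_value_eq (g : G.Mor) {V : Opens X} (hg : G.t g ∈ V) :
    ∃ a : C.Stalk (G.s g) V, e.value a = g := by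
  obtain ⟨U, hU, f, hf⟩ := G.exists_section_through g V hg
  refine ⟨C.germ ((e.equiv U V).symm f) _ hU, ?_⟩
  rw [value_germ, eval, Equiv.apply_symm_apply, hf]

theorem value_push {x : X} {V W : Opens X} (k : C.Hom V W) (a : C.Stalk x V) :
    e.value (C.push k x a) =
      G.comp (e.eval k ⟨G.t (e.value a), e.t_value_mem a⟩) (e.value a) (e.s_eval k ⟨_, e.t_value_mem a⟩).symm := by
  obtain ⟨U, hU, f, rfl⟩ := C.exists_germ_eq a
  simp only [push_germ, value_germ, eval_comp]

theorem value_push_incl {x : X} {V W : Opens X} (h : V ≤ W) (a : C.Stalk x V) :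
    e.value (C.push (C.incl h) x a) = e.value a := by
  rw [value_push]
  refine Eq.trans ?_ (G.id_comp (e.value a))
  exact G.comp_congr (e.eval_incl h _) rfl _ _

/-- The morphism of `G` corresponding to an element of `C_x^y`. -/
noncomputable def germValue {x y : X} (a : C.Germ x y) : G.Mor := e.value (a.val ⊤ trivial)

/-- Pushing along an inclusion does not change the arrow, so a compatible family amounts to one
arrow, read off at V = X. -/
theorem value_val {x y : X} (a : C.Germ x y) (V : Opens X) (hV : y ∈ V) :
    e.value (a.val V hV) = e.germValue a := by
  rw [germValue, ← a.compat le_top hV, value_push_incl]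

theorem s_germValue {x y : X} (a : C.Germ x y) : G.s (e.germValue a) = x := e.s_value _

/-- The separation axiom enters here. If the target were another point, its complement would be an
open neighbourhood of y that must contain it. -/
theorem t_germValue [T1Space X] {x y : X} (a : C.Germ x y) : G.t (e.germValue a) = y := by
  by_contra h
  let V : Opens X := ⟨{G.t (e.germValue a)}ᶜ, isOpen_compl_singleton⟩
  have hV : y ∈ V := Ne.symm h
  have := e.t_value_mem (a.val V hV)
  rw [value_val] at this
  exact this rfl

theorem germValue_injective {x y : X} :
    Function.Injective (e.germValue : C.Germ x y → G.Mor) := by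
  intro a b h
  ext V hV
  exact e.value_injective (by rw [value_val, value_val, h])

/-- Each neighbourhood of the target of g has a germ with value g; the family is compatible because
values determine germs. -/
theorem exists_germValue_eq (g : G.Mor) :
    ∃ a : C.Germ (G.s g) (G.t g), e.germValue a = g := by
  choose v hv using fun (V : Opens X) (hV : G.t g ∈ V) => e.exists_value_eq g hV
  exact ⟨⟨v, fun h hV => e.value_injective (by rw [value_push_incl, hv, hv])⟩, hv _ _⟩

theorem exists_germValue_eq' {x y : X} (g : G.Mor) (hs : G.s g = x) (ht : G.t g = y) :
    ∃ a : C.Germ x y, e.germValue a = g := by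
  subst hs ht
  exact e.exists_germValue_eq g

theorem germValue_id (x : X) : e.germValue (Germ.id C x) = G.i x := by
  refine (e.value_germ (C.id ⊤) (Opens.mem_top x)).trans ?_
  rw [← C.incl_refl, eval_incl]

theorem germValue_comp [T1Space X] {x y z : X} (b : C.Germ y z) (a : C.Germ x y) :
    e.germValue (b.comp a) = G.comp (e.germValue b) (e.germValue a)
      ((e.t_germValue a).trans (e.s_germValue b).symm) := by
  change e.value (a.act ⊤ (b.val ⊤ trivial)) = _
  obtain ⟨V, hV, g, hg⟩ := C.exists_germ_eq (b.val ⊤ trivial)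
  have hb : e.germValue b = e.eval g ⟨y, hV⟩ := by rw [germValue, ← hg, value_germ]
  rw [← hg, Germ.act_germ, value_push]
  refine G.comp_congr ?_ (e.value_val a V hV) _ _
  rw [hb]
  congr 1
  exact Subtype.ext ((congrArg G.t (e.value_val a V hV)).trans (e.t_germValue a))

/-- Both sides are the set of arrows of G from x into V, on the left sorted by target. -/
theorem stalk_coprod [T1Space X] (e : SectionsIso C G) (x : X) (V : Opens X) : Function.Bijective
    fun p : (Σ y : V, C.Germ x (y : X)) => p.2.val V p.1.2 := by
  constructor
  · rintro ⟨⟨y, hy⟩, a⟩ ⟨⟨y', hy'⟩, b⟩ h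
    have h' : e.germValue a = e.germValue b := by
      rw [← e.value_val a V hy, ← e.value_val b V hy']
      exact congrArg e.value h
    obtain rfl : y = y' :=
      (e.t_germValue a).symm.trans ((congrArg G.t h').trans (e.t_germValue b))
    rw [e.germValue_injective h']
  · intro a
    obtain ⟨b, hb⟩ := e.exists_germValue_eq' (e.value a) (e.s_value a) rfl
    exact ⟨⟨⟨_, e.t_value_mem a⟩, b⟩, e.value_injective ((e.value_val _ _ _).trans hb)⟩

theorem star_groupoid [T1Space X] (e : SectionsIso C G) {x y : X} (a : C.Germ x y) :
    ∃ b : C.Germ y x, b.comp a = Germ.id C x ∧ a.comp b = Germ.id C y := by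
  obtain ⟨b, hb⟩ := e.exists_germValue_eq' (G.inv (e.germValue a))
    ((G.s_inv _).trans (e.t_germValue a)) ((G.t_inv _).trans (e.s_germValue a))
  refine ⟨b, e.germValue_injective ?_, e.germValue_injective ?_⟩
  · rw [germValue_comp, germValue_id, G.comp_congr hb rfl _ (G.s_inv _).symm, G.inv_comp,
      s_germValue]
  · rw [germValue_comp, germValue_id, G.comp_congr rfl hb _ (G.t_inv _), G.comp_inv,
      t_germValue]

end SectionsIso

/-- The pseudogroup sheaf of local sections of an étale groupoid over a `T₁` space. -/
def EtaleGroupoid.sectionsSheaf {X : TopCat.{u}} [T1Space X] (G : EtaleGroupoid X) :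
    PseudogroupSheaf X where
  toOpensCategory := G.sections
  stalk_coprod := (SectionsIso.refl G).stalk_coprod
  star_groupoid := (SectionsIso.refl G).star_groupoid
  isSheaf := G.sections_presheaf_isSheaf

/-! ### Recovering G from its local sections -/

open OpensCategory in
theorem PseudogroupSheaf.starGroupoid_isomorphic {X : TopCat.{u}} [T1Space X]
    (C : PseudogroupSheaf X) {G : EtaleGroupoid X} (e : SectionsIso C.toOpensCategory G) :
    C.starGroupoid.Isomorphic G := by
  let φ : C.StarMor → G.Mor := fun a => e.germValue a.germ
  have hφs : ∀ a, G.s (φ a) = a.src := fun a => e.s_germValue a.germ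
  have hφt : ∀ a, G.t (φ a) = a.tgt := fun a => e.t_germValue a.germ
  have hφ : ∀ (a : C.StarMor) {U V : Opens X} (f : C.Hom U V) (h : a.IsRepresentedBy f),
      φ a = e.eval f ⟨a.src, h.1⟩ := by
    rintro a U V f ⟨hU, hV, h⟩
    rw [← e.value_germ f hU, ← h, e.value_val]
  have hcont : Continuous φ := by
    refine continuous_iff_continuousAt.2 fun a => ?_
    obtain ⟨U, f, hf⟩ := a.exists_isRepresentedBy ⊤ trivial
    refine ContinuousOn.continuousAt (s := StarMor.representedBy f) ?_
      ((C.isOpen_representedBy f).mem_nhds hf)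
    rw [continuousOn_iff_continuous_domRestrict]
    have : Set.domRestrict (StarMor.representedBy f) φ =
        e.eval f ∘ fun b => ⟨b.1.src, b.2.1⟩ := funext fun b => hφ b.1 f b.2
    rw [this]
    exact (e.continuous_eval f).comp
      ((C.continuous_src.comp continuous_subtype_val).subtype_mk _)
  have hbij : Function.Bijective φ := by
    constructor
    · rintro ⟨x, y, a⟩ ⟨x', y', b⟩ h
      obtain rfl : x = x' := by
        rw [← e.s_germValue a, ← e.s_germValue b]
        exact congrArg G.s h
      obtain rfl : y = y' := by
        rw [← e.t_germValue a, ← e.t_germValue b]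
        exact congrArg G.t h
      exact congrArg _ (e.germValue_injective h)
    · intro g
      obtain ⟨a, ha⟩ := e.exists_germValue_eq g
      exact ⟨⟨_, _, a⟩, ha⟩
  -- The maps s and s ∘ φ are local homeomorphisms and φ is continuous, so φ is one too; being
  -- bijective, it is a homeomorphism.
  have hloc : IsLocalHomeomorph φ := by
    refine IsLocalHomeomorph.of_comp (g := G.s) ?_ G.etale_s hcont
    exact (funext hφs : G.s ∘ φ = StarMor.src) ▸ C.isLocalHomeomorph_src
  let ψ : C.StarMor ≃ₜ G.Mor := (Equiv.ofBijective φ hbij).toHomeomorphOfContinuousOpen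
    hcont hloc.isOpenMap
  refine ⟨ψ, hφs, hφt, fun x => e.germValue_id x, ?_⟩
  rintro ⟨y, z, b⟩ ⟨x, y', a⟩ h h'
  obtain rfl : y' = y := h
  exact e.germValue_comp b a

/-! ### Recovering C from C⋆ -/

namespace PseudogroupSheaf

open OpensCategory OpensCategory.StarMor

variable {X : TopCat.{u}} (C : PseudogroupSheaf X)

-- A common represented arrow at x makes the germs at x equal, and C(-, V) is separated.
variable {C} in
theorem hom_ext {U V : Opens X} {f f' : C.Hom U V}
    (h : ∀ x ∈ U, ∃ a : C.StarMor, a.src = x ∧ a.IsRepresentedBy f ∧ a.IsRepresentedBy f') :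
    f = f' := by
  refine TopCat.Presheaf.section_ext ⟨C.presheaf V, C.isSheaf V⟩ U f f' fun x hx => ?_
  obtain ⟨a, rfl, ⟨_, _, e⟩, ⟨_, _, e'⟩⟩ := h x hx
  exact e.symm.trans e'

theorem exists_localSection_eq {U V : Opens X} {σ : U → C.StarMor} (hσ : Continuous σ)
    (hs : ∀ x, (σ x).src = x) (ht : ∀ x, (σ x).tgt ∈ V) :
    ∃ f : C.Hom U V, C.localSection f = σ := by
  choose U' f hf using fun x => (σ x).exists_isRepresentedBy V (ht x)
  -- W x is the set of points where f x represents σ, open by continuity of σ. On W x ⊓ W y both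
  -- restrictions represent σ, so `hom_ext` lets them glue.
  let W : U → Opens X := fun x => ⟨_, U.isOpen.isOpenMap_subtype_val _
    ((C.isOpen_representedBy (f x)).preimage hσ)⟩
  have hW : ∀ (x : U) (y : U), (y : X) ∈ W x → (σ y).IsRepresentedBy (f x) := by
    rintro x y ⟨y', hy', h⟩
    rw [← Subtype.ext h]
    exact hy'
  have hWU : ∀ x, W x ≤ U := by
    rintro x _ ⟨y, -, rfl⟩
    exact y.2
  have hWU' : ∀ x, W x ≤ U' x := fun x y hy => by
    have := (hW x ⟨y, hWU x hy⟩ hy).1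
    rwa [hs] at this
  have hmem : ∀ x : U, (x : X) ∈ W x := fun x => ⟨x, hf x, rfl⟩
  let sf : ∀ x : U, C.Hom (W x) V := fun x => C.comp (f x) (C.incl (hWU' x))
  have hsf : ∀ (x y : U), (y : X) ∈ W x → (σ y).IsRepresentedBy (sf x) := fun x y hy =>
    (isRepresentedBy_comp_incl_iff _).2 ⟨hW x y hy, by rwa [hs]⟩
  obtain ⟨g, hg, -⟩ := TopCat.Sheaf.existsUnique_gluing' ⟨C.presheaf V, C.isSheaf V⟩ W U
    (fun x => homOfLE (hWU x)) (fun x hx => Opens.mem_iSup.2 ⟨⟨x, hx⟩, hmem ⟨x, hx⟩⟩) sf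
    fun x y => hom_ext (C := C) (U := W x ⊓ W y) fun z hz => ⟨σ ⟨z, hWU x hz.1⟩, hs _,
      (isRepresentedBy_comp_incl_iff inf_le_left).2 ⟨hsf x _ hz.1, by rwa [hs]⟩,
      (isRepresentedBy_comp_incl_iff inf_le_right).2 ⟨hsf y _ hz.2, by rwa [hs]⟩⟩
  refine ⟨g, funext fun x => ?_⟩
  have hgx : C.comp g (C.incl (hWU x)) = sf x := hg x
  have h := hsf x x (hmem x)
  rw [← hgx] at h
  exact starMor_ext (C.localSection_isRepresentedBy g x) ((isRepresentedBy_comp_incl_iff _).1 h).1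
    ((C.localSection_src g x).trans (hs x).symm)

/-- The isomorphism, relative to `X_top`, from a pseudogroup sheaf `C` to the category of local
sections of `C⋆`. -/
noncomputable def sectionsIso : SectionsIso C.toOpensCategory C.starGroupoid where
  equiv U V := Equiv.ofBijective
    (fun f => ⟨C.localSection f, C.continuous_localSection f, C.localSection_src f, C.localSection_tgt_mem f⟩) <| by
      constructor
      · intro f f' h
        refine hom_ext fun x hx => ⟨C.localSection f ⟨x, hx⟩, C.localSection_src f _,
          C.localSection_isRepresentedBy f _, ?_⟩
        have h' : C.localSection f = C.localSection f' := congrArg Subtype.val h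
        rw [h']
        exact C.localSection_isRepresentedBy f' _
      · rintro ⟨σ, hσ, hs, ht⟩
        obtain ⟨f, rfl⟩ := C.exists_localSection_eq hσ hs ht
        exact ⟨f, rfl⟩
  equiv_comp {U V W} g f := by
    refine Subtype.ext (funext fun x => ?_)
    let y : V := ⟨(C.localSection f x).tgt, C.localSection_tgt_mem f x⟩
    have h : (C.localSection f x).tgt = (C.localSection g y).src := (C.localSection_src g y).symm
    -- Both arrows start at x and are represented by g ∘ f.
    exact starMor_ext (C.localSection_isRepresentedBy (C.comp g f) x)
      ((C.localSection_isRepresentedBy g y).comp (C.localSection_isRepresentedBy f x) h)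
      ((C.localSection_src _ x).trans (C.localSection_src f x).symm)
  equiv_incl {U V} h := by
    refine Subtype.ext (funext fun x => ?_)
    exact starMor_ext (C.localSection_isRepresentedBy (C.incl h) x)
      ((isRepresentedBy_id_iff h).2 x.2) (C.localSection_src _ x)

theorem isomorphic_sectionsSheaf [T1Space X] : C.Isomorphic C.starGroupoid.sectionsSheaf :=
  ⟨C.sectionsIso.equiv, fun _ _ _ => C.sectionsIso.equiv_comp, fun _ _ => C.sectionsIso.equiv_incl⟩

-- Composing with D ≅ (D⋆)^ makes C a category of local sections of D⋆, so `starGroupoid_isomorphic`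
-- applies and germs need not be transported along the isomorphism.
variable {C} in
theorem Isomorphic.starGroupoid [T1Space X] {D : PseudogroupSheaf X} (h : C.Isomorphic D) :
    C.starGroupoid.Isomorphic D.starGroupoid := by
  obtain ⟨φ, hc, hi⟩ :=
    (PseudogroupSheaf.isoSetoid X).iseqv.trans h D.isomorphic_sectionsSheaf
  exact C.starGroupoid_isomorphic ⟨φ, fun {_ _ _} => hc _ _ _, fun {_ _} => hi _ _⟩

end PseudogroupSheaf

/-! ### The bijection on isomorphism classes -/

theorem EtaleGroupoid.Isomorphic.sectionsSheaf {X : TopCat.{u}} [T1Space X] {G H : EtaleGroupoid X}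
    (h : G.Isomorphic H) : G.sectionsSheaf.Isomorphic H.sectionsSheaf := by
  obtain ⟨φ, hs, ht, hi, hc⟩ := h
  have hs' : ∀ f, G.s (φ.symm f) = H.s f := fun f => by rw [← hs, φ.apply_symm_apply]
  have ht' : ∀ f, G.t (φ.symm f) = H.t f := fun f => by rw [← ht, φ.apply_symm_apply]
  let ψ (U V : Opens X) : G.sections.Hom U V ≃ H.sections.Hom U V :=
    { toFun := fun f => ⟨φ ∘ f.1, φ.continuous.comp f.2.1, fun x => (hs _).trans (f.2.2.1 x),
        fun x => (ht (f.1 x)).symm ▸ f.2.2.2 x⟩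
      invFun := fun f => ⟨φ.symm ∘ f.1, φ.symm.continuous.comp f.2.1,
        fun x => (hs' _).trans (f.2.2.1 x), fun x => (ht' (f.1 x)).symm ▸ f.2.2.2 x⟩
      left_inv := fun f => Subtype.ext (funext fun x => φ.symm_apply_apply _)
      right_inv := fun f => Subtype.ext (funext fun x => φ.apply_symm_apply _) }
  refine ⟨ψ, fun U V W g f => ?_, fun U V h => Subtype.ext (funext fun x => hi x)⟩
  refine Subtype.ext (funext fun x => ?_)
  -- In H the outer section is evaluated at t(φ(f x)), which equals t(f x) only propositionally;
  -- hence the congruence.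
  refine (hc _ _ _ ?_).trans (H.comp_congr ?_ rfl _ _)
  · rw [ht, hs, g.2.2.1]
  · exact congrArg (φ ∘ g.1) (Subtype.ext (ht _).symm)

theorem theorem2p6 (X : TopCat.{u}) [T1Space X] :
    ∃ Φ : Quotient (EtaleGroupoid.isoSetoid X) ≃ Quotient (PseudogroupSheaf.isoSetoid X),
      (∀ G : EtaleGroupoid X, ∃ C : PseudogroupSheaf X,
        C.toOpensCategory = G.sections ∧ Φ (Quotient.mk _ G) = Quotient.mk _ C) ∧
      (∀ C : PseudogroupSheaf X, ∃ G : EtaleGroupoid X,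
        G.toCategoryOver = C.star ∧ Φ.symm (Quotient.mk _ C) = Quotient.mk _ G) := by

  let Φ : Quotient (EtaleGroupoid.isoSetoid X) ≃ Quotient (PseudogroupSheaf.isoSetoid X) :=
    { toFun := Quotient.map EtaleGroupoid.sectionsSheaf fun _ _ h =>
        EtaleGroupoid.Isomorphic.sectionsSheaf h
      invFun := Quotient.map PseudogroupSheaf.starGroupoid fun _ _ h =>
        PseudogroupSheaf.Isomorphic.starGroupoid h
      left_inv := by
        rintro ⟨G⟩
        exact Quotient.sound (G.sectionsSheaf.starGroupoid_isomorphic (SectionsIso.refl G))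
      right_inv := by
        rintro ⟨C⟩
        exact Quotient.sound ((PseudogroupSheaf.isoSetoid X).iseqv.symm C.isomorphic_sectionsSheaf) }
  exact ⟨Φ, fun G => ⟨G.sectionsSheaf, rfl, rfl⟩, fun C => ⟨C.starGroupoid, rfl, rfl⟩⟩
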